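/- For a real $k\times m$ matrix $F$ and a finite set $\mathscr A\subset\mathbb R$ let $\mathscr D_{\mathrm s}(F,\mathscr A):=\sup_{\|x\|_2\le 1}\inf_{q\in\mathscr A^m}\|x-Fq\|_2$, where $x$ ranges over the closed Euclidean unit ball of $\mathbb R^k$. For a real $m\times k$ matrix $E$ and an integer $L\ge 2$ let $$\mathscr D_{\mathrm a}(E,L):=\inf\{\mathscr D_{\mathrm s}(F,\mathscr A): \mathscr A\subset\mathbb R,\ |\mathscr A|=L,\ F\in\mathbb R^{k\times m},\ FE=I\}$$ (with the value $+\infty$ if no $F$ satisfies $FE=I$). **Corollary.** There is an absolute constant $c_1>0$ with the following property. Let $\eta\in(0,1/2)$ and let $m,k$ be positive integers with $k\ge 4/\eta$, $m\ge 2k$ and $\frac mk\ge\frac{c_1}{\eta^2}\log\frac mk$. Let $E$ be an $m\times k$ random matrix whose entries are independent standard Gaussian $\mathcal N(0,1)$ random variables. Then, with probability at least $1-3\cdot 2^{-\eta^2m/40}-e^{-2m}$, $$\mathscr D_{\mathrm a}(E,L)<16e\,m^{3/2}k^{-1}L^{-(1-\eta)m/k}\qquad\text{for all integers } L\ge 2\text{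 simultaneously}.$$ -/

import Mathlib

open MeasureTheory ProbabilityTheory
open scoped ENNReal Matrix

/-- The synthesis distortion of the frame formed by the columns of `F`, for the quantization
alphabet `A` and the signal set `X`: the supremum over `x ∈ X` of the infimum over `q ∈ A ^ m` of
the Euclidean distance from `x` to `F q`, as an element of `[0, ∞]`. -/
noncomputable def synthesisDistortion {m k : ℕ} (F : Matrix (Fin k) (Fin m) ℝ) (A : Finset ℝ)
    (X : Set (EuclideanSpace ℝ (Fin k))) : ℝ≥0∞ :=
  ⨆ x ∈ X, ⨅ q : Fin m → ℝ, ⨅ _ : ∀ i, q i ∈ A, ‖x - WithLp.toLp 2 (F *ᵥ q)‖ₑ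

/-- The analysis distortion of the frame formed by the rows of `E`: the infimum of the synthesis
distortions of all its duals, that is of all `F` with `F E = I` (it is `∞` if there is none). -/
noncomputable def analysisDistortion {m k : ℕ} (E : Matrix (Fin m) (Fin k) ℝ) (A : Finset ℝ)
    (X : Set (EuclideanSpace ℝ (Fin k))) : ℝ≥0∞ :=
  ⨅ F : Matrix (Fin k) (Fin m) ℝ, ⨅ _ : F * E = 1, synthesisDistortion F A X

/-- `D_a(E, L)`: the least analysis distortion of `E` over the Euclidean unit ball, among all
alphabets with exactly `L` elements. -/
noncomputable def analysisDistortionLevels {m k : ℕ} (E : Matrix (Fin m) (Fin k) ℝ)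
    (L : ℕ) : ℝ≥0∞ :=
  ⨅ A : Finset ℝ, ⨅ _ : A.card = L, analysisDistortion E A (Metric.closedBall 0 1)

/-- The entries of the random matrix `E` are independent standard Gaussian random variables. -/
structure IsStandardGaussianMatrix {Ω : Type*} [MeasurableSpace Ω] {m k : ℕ}
    (E : Ω → Matrix (Fin m) (Fin k) ℝ) (P : Measure Ω) : Prop where
  hasLaw : ∀ i j, HasLaw (fun ω => E ω i j) (gaussianReal 0 1) P
  indep : iIndepFun (fun (p : Fin m × Fin k) ω => E ω p.1 p.2) P

/-! Take `p` slightly larger than `k`, about `(1 + η / 2) k`, and cut the measurements `y = E x`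
into `p` blocks of length `n = ⌊m / p⌋`. The matrix `W` adds up each block with geometric weights in
`β = L n / (n + 1)`. Greedy noise shaping chooses `q` so that every coordinate of `W (y - q)` is at
most `δ`. If `N` is a left inverse of `W E`, then `N W` is a dual of `E` with error at most `√p δ /
σ`, where `σ` bounds the singular values of `W E` from below
(`analysisDistortionLevels_le_of_blockMatrix`).

The rows of `W` are orthogonal of equal norm `c ≥ L ^ (n - 1) / e`, so `W E` is `c` times a `p × k`
Gaussian matrix. The excess `p - k` makes a singular value below `t √p c` unlikely: the probability
is about `t ^ (p - k)` (`stdGaussian_exists_norm_mulVec_lt_le`). With `t = L ^ (-η m / (4 k))` the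
loss in `σ` is affordable, and the failure probabilities are summable over `L`
(`small_ball_bound_le_rpow`, `tsum_ofReal_rpow_neg_le`). The operator norm of `E` is controlled once
for all `L`. -/

/-! ### Gaussian vectors: linear images, small balls and tails -/

lemma charFun_stdGaussian_map_of_norm_adjoint {H F : Type*}
    [NormedAddCommGroup H] [InnerProductSpace ℝ H] [FiniteDimensional ℝ H] [MeasurableSpace H]
    [BorelSpace H] [NormedAddCommGroup F] [InnerProductSpace ℝ F] [FiniteDimensional ℝ F]
    [MeasurableSpace F] [BorelSpace F] (T : H →L[ℝ] F) {c : ℝ}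
    (hT : ∀ y, ‖ContinuousLinearMap.adjoint T y‖ = c * ‖y‖) (y : F) :
    charFun ((stdGaussian H).map T) y = Complex.exp (-((c * ‖y‖ : ℝ) : ℂ) ^ 2 / 2) := by
  have : charFun ((stdGaussian H).map T) y
      = charFun (stdGaussian H) (ContinuousLinearMap.adjoint T y) := by
    rw [charFun_apply, charFun_apply, integral_map (by fun_prop)
      (Measurable.aestronglyMeasurable (by fun_prop))]
    simp_rw [ContinuousLinearMap.adjoint_inner_right]
  rw [this, charFun_stdGaussian, hT]

lemma stdGaussian_map_eq_map_smul {H F : Type*}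
    [NormedAddCommGroup H] [InnerProductSpace ℝ H] [FiniteDimensional ℝ H] [MeasurableSpace H]
    [BorelSpace H] [NormedAddCommGroup F] [InnerProductSpace ℝ F] [FiniteDimensional ℝ F]
    [MeasurableSpace F] [BorelSpace F] (T : H →L[ℝ] F) {c : ℝ} (hc : 0 ≤ c)
    (hT : ∀ y, ‖ContinuousLinearMap.adjoint T y‖ = c * ‖y‖) :
    (stdGaussian H).map T = (stdGaussian F).map (fun z => c • z) := by
  have h2 : (stdGaussian F).map (fun z => c • z)
      = (stdGaussian F).map (c • ContinuousLinearMap.id ℝ F) := rfl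
  rw [h2]
  apply Measure.ext_of_charFun
  ext y
  rw [charFun_stdGaussian_map_of_norm_adjoint T hT,
    charFun_stdGaussian_map_of_norm_adjoint (c • ContinuousLinearMap.id ℝ F) (c := c)]
  intro y
  rw [map_smulₛₗ]
  have h3 : ContinuousLinearMap.adjoint (ContinuousLinearMap.id ℝ F) = .id ℝ F :=
    ContinuousLinearMap.adjoint_id
  rw [h3]
  simp [norm_smul, abs_of_nonneg hc]

/-- Both signs of `a` are needed: large positive values give small-ball bounds, `a = -1 / 4` gives
the upper tail. -/
lemma lintegral_exp_neg_mul_sq_gaussianReal {a : ℝ} (ha : -(1 / 2) < a) :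
    ∫⁻ x, ENNReal.ofReal (Real.exp (-a * x ^ 2)) ∂(gaussianReal 0 1)
      = ENNReal.ofReal (√(1 + 2 * a))⁻¹ := by
  have hpos : 0 < 1 / 2 + a := by linarith
  rw [gaussianReal_of_var_ne_zero _ one_ne_zero,
    lintegral_withDensity_eq_lintegral_mul _ (measurable_gaussianPDF _ _) (by fun_prop)]
  have h1 : ∀ x : ℝ, (gaussianPDF 0 1 * fun x => ENNReal.ofReal (Real.exp (-a * x ^ 2))) x
      = ENNReal.ofReal ((√(2 * Real.pi))⁻¹ * Real.exp (-(1 / 2 + a) * x ^ 2)) := by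
    intro x
    rw [Pi.mul_apply, gaussianPDF, ← ENNReal.ofReal_mul (gaussianPDFReal_nonneg _ _ _),
      gaussianPDFReal, mul_assoc, ← Real.exp_add]
    congr 2
    · simp
    · congr 1
      simp
      ring
  simp_rw [h1]
  rw [← ofReal_integral_eq_lintegral_ofReal ((integrable_exp_neg_mul_sq hpos).const_mul _)
    (Filter.Eventually.of_forall fun x => by positivity), integral_const_mul, integral_gaussian]
  congr 1
  rw [← Real.sqrt_inv, ← Real.sqrt_mul (by positivity), ← Real.sqrt_inv]
  congr 1
  have := Real.pi_pos
  have : (1 + 2 * a) ≠ 0 := by linarith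
  field_simp

lemma lintegral_exp_neg_mul_norm_sq_stdGaussian {ι : Type*} [Fintype ι] {a : ℝ}
    (ha : -(1 / 2) < a) :
    ∫⁻ z, ENNReal.ofReal (Real.exp (-a * ‖z‖ ^ 2)) ∂(stdGaussian (EuclideanSpace ℝ ι))
      = ENNReal.ofReal (√(1 + 2 * a))⁻¹ ^ Fintype.card ι := by
  rw [← map_pi_eq_stdGaussian, lintegral_map (by fun_prop) (by fun_prop)]
  have h1 : ∀ z : ι → ℝ, ENNReal.ofReal (Real.exp (-a * ‖WithLp.toLp 2 z‖ ^ 2))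
      = ∏ i, ENNReal.ofReal (Real.exp (-a * z i ^ 2)) := by
    intro z
    rw [← ENNReal.ofReal_prod_of_nonneg (fun _ _ => (Real.exp_pos _).le), ← Real.exp_sum,
      ← Finset.mul_sum, EuclideanSpace.norm_sq_eq]
    simp
  simp_rw [h1]
  rw [lintegral_prod_eq_prod_lintegral_of_indepFun Finset.univ
    (fun i (z : ι → ℝ) => ENNReal.ofReal (Real.exp (-a * z i ^ 2)))
    (iIndepFun_pi (X := fun _ x => ENNReal.ofReal (Real.exp (-a * x ^ 2)))
      fun _ => by fun_prop) (fun _ => by fun_prop), ← Finset.card_univ]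
  refine Finset.prod_eq_pow_card fun i _ => ?_
  rw [← lintegral_exp_neg_mul_sq_gaussianReal ha]
  exact (measurePreserving_eval (fun _ : ι => gaussianReal 0 1) i).lintegral_comp
    (f := fun x => ENNReal.ofReal (Real.exp (-a * x ^ 2))) (by fun_prop)

lemma stdGaussian_norm_le_le {p : ℕ} (hp : 0 < p) {s : ℝ} (hs : 0 < s) :
    stdGaussian (EuclideanSpace ℝ (Fin p)) {z | ‖z‖ ≤ s * √p}
      ≤ ENNReal.ofReal (2 * s) ^ p := by
  have hp' : (0 : ℝ) < p := by exact_mod_cast hp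
  -- With this `a` Markov's inequality has threshold `e ^ (-p / 2)` and mean at most `s ^ p`;
  -- finally `e ^ (1 / 2) ≤ 2`.
  set a : ℝ := 1 / (2 * s ^ 2) with ha
  have ha0 : 0 < a := by positivity
  have hsub : {z : EuclideanSpace ℝ (Fin p) | ‖z‖ ≤ s * √p} ⊆
      {z | ENNReal.ofReal (Real.exp (-(p / 2))) ≤ ENNReal.ofReal (Real.exp (-a * ‖z‖ ^ 2))} := by
    intro z hz
    simp only [Set.mem_ofPred_eq] at hz ⊢
    apply ENNReal.ofReal_le_ofReal
    apply Real.exp_le_exp.2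
    have : ‖z‖ ^ 2 ≤ s ^ 2 * p := by
      calc ‖z‖ ^ 2 ≤ (s * √p) ^ 2 := by gcongr
        _ = s ^ 2 * p := by rw [mul_pow, Real.sq_sqrt hp'.le]
    have h2 : a * ‖z‖ ^ 2 ≤ a * (s ^ 2 * p) := by gcongr
    have h3 : a * (s ^ 2 * p) = p / 2 := by rw [ha]; field_simp
    linarith
  refine (measure_mono hsub).trans ?_
  refine (meas_ge_le_lintegral_div (by fun_prop) (by simp [Real.exp_pos]) (by simp)).trans ?_
  rw [lintegral_exp_neg_mul_norm_sq_stdGaussian (by linarith), Fintype.card_fin,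
    ← ENNReal.ofReal_pow (by positivity), ← ENNReal.ofReal_pow (by positivity),
    ← ENNReal.ofReal_div_of_pos (Real.exp_pos _)]
  apply ENNReal.ofReal_le_ofReal
  have h4 : Real.exp (-(p / 2 : ℝ)) = (Real.exp (-(1 / 2))) ^ p := by
    rw [← Real.exp_nat_mul]; congr 1; ring
  rw [h4, ← div_pow]
  have h5 : (√(1 + 2 * a))⁻¹ ≤ s := by
    rw [inv_le_comm₀ (by positivity) hs]
    apply Real.le_sqrt_of_sq_le
    have : 2 * a = s⁻¹ ^ 2 := by rw [ha]; field_simp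
    linarith
  have h6 : (1 / 2 : ℝ) ≤ Real.exp (-(1 / 2)) := by
    have := Real.add_one_le_exp (-(1 / 2) : ℝ)
    linarith
  gcongr
  rw [div_le_iff₀ (Real.exp_pos _)]
  nlinarith

lemma stdGaussian_le_norm_le {ι : Type*} [Fintype ι] {s : ℝ} (hs : 0 ≤ s) :
    stdGaussian (EuclideanSpace ℝ ι) {z | s ≤ ‖z‖}
      ≤ ENNReal.ofReal (Real.exp (Fintype.card ι - s ^ 2 / 4)) := by
  have hsub : {z : EuclideanSpace ℝ ι | s ≤ ‖z‖} ⊆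
      {z | ENNReal.ofReal (Real.exp (s ^ 2 / 4))
        ≤ ENNReal.ofReal (Real.exp (-(-(1 / 4)) * ‖z‖ ^ 2))} := by
    intro z hz
    simp only [Set.mem_ofPred_eq] at hz ⊢
    apply ENNReal.ofReal_le_ofReal
    apply Real.exp_le_exp.2
    have : s ^ 2 ≤ ‖z‖ ^ 2 := by gcongr
    linarith
  refine (measure_mono hsub).trans ?_
  refine (meas_ge_le_lintegral_div (by fun_prop) (by simp [Real.exp_pos]) (by simp)).trans ?_
  rw [lintegral_exp_neg_mul_norm_sq_stdGaussian (by norm_num),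
    ← ENNReal.ofReal_pow (by positivity),
    ← ENNReal.ofReal_div_of_pos (Real.exp_pos _)]
  apply ENNReal.ofReal_le_ofReal
  rw [Real.exp_sub]
  gcongr
  rw [← mul_one (Fintype.card ι : ℝ), Real.exp_nat_mul]
  gcongr
  rw [← Real.sqrt_inv]
  apply Real.sqrt_le_iff.2 ⟨(Real.exp_pos _).le, ?_⟩
  have := Real.add_one_le_exp (1 : ℝ)
  have : (1 + 2 * -(1 / 4 : ℝ))⁻¹ = 2 := by norm_num
  rw [this]
  nlinarith

/-! ### A volume argument in place of nets -/

/-- For `ω ∈ B` one bad point forces a whole ball of bad points, so the bad volume is at least that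
of a `ρ`-ball. By Fubini its mean is at most `b` times the volume of the `R`-ball, and Markov's
inequality gives the ratio of volumes. This replaces a union bound over a net. -/
lemma measure_le_of_closedBall_subset {Ω V : Type*} [MeasurableSpace Ω] [NormedAddCommGroup V]
    [NormedSpace ℝ V] [FiniteDimensional ℝ V] [MeasurableSpace V] [BorelSpace V]
    (μ : Measure Ω) [SFinite μ] {S : Set (Ω × V)} (hS : MeasurableSet S) {B : Set Ω} {ρ R b : ℝ}
    (hρ : 0 < ρ) (hR : 0 ≤ R) (hb : 0 ≤ b)
    (hball : ∀ ω ∈ B, ∃ x₀, Metric.closedBall x₀ ρ ⊆ {x | (ω, x) ∈ S})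
    (hSR : ∀ ω x, (ω, x) ∈ S → ‖x‖ ≤ R)
    (hSb : ∀ x, μ {ω | (ω, x) ∈ S} ≤ ENNReal.ofReal b) :
    μ B ≤ ENNReal.ofReal ((R / ρ) ^ Module.finrank ℝ V * b) := by
  obtain ⟨ν, hν⟩ : ∃ ν : Measure V, ν.IsAddHaarMeasure := ⟨Measure.addHaar, inferInstance⟩
  set d := Module.finrank ℝ V
  set v := ν (Metric.ball 0 1)
  have hv0 : v ≠ 0 := (Metric.measure_ball_pos ν 0 one_pos).ne'
  have hvt : v ≠ ∞ := measure_ball_lt_top.ne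
  have hsub : B ⊆ {ω | ENNReal.ofReal (ρ ^ d) * v ≤ ν (Prod.mk ω ⁻¹' S)} := by
    intro ω hω
    obtain ⟨x₀, hx⟩ := hball ω hω
    rw [Set.mem_ofPred_eq, ← Measure.addHaar_closedBall ν x₀ hρ.le]
    exact measure_mono hx
  have h1 : μ.prod ν S ≤ ENNReal.ofReal b * (ENNReal.ofReal (R ^ d) * v) := by
    rw [Measure.prod_apply_symm hS, ← Measure.addHaar_closedBall ν 0 hR, ← setLIntegral_const,
      ← lintegral_indicator measurableSet_closedBall]
    apply lintegral_mono
    intro x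
    by_cases hx : x ∈ Metric.closedBall (0 : V) R
    · rw [Set.indicator_of_mem hx]
      exact hSb x
    · have : ((fun ω => (ω, x)) ⁻¹' S) = ∅ := by
        ext ω
        simp only [Set.mem_preimage, Set.mem_empty_iff_false, iff_false]
        intro h
        exact hx (mem_closedBall_zero_iff.2 (hSR _ _ h))
      simp only [this, measure_empty, zero_le]
  rw [Measure.prod_apply hS] at h1
  have hc0 : ENNReal.ofReal (ρ ^ d) * v ≠ 0 :=
    mul_ne_zero (by simpa using pow_pos hρ d) hv0
  have hct : ENNReal.ofReal (ρ ^ d) * v ≠ ∞ := ENNReal.mul_ne_top (by simp) hvt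
  refine (measure_mono hsub).trans ?_
  refine (meas_ge_le_lintegral_div (measurable_measure_prodMk_left hS).aemeasurable
    hc0 hct).trans ?_
  refine (ENNReal.div_le_div_right h1 _).trans (le_of_eq ?_)
  rw [← mul_assoc, ENNReal.mul_div_mul_right _ _ hv0 hvt, ← ENNReal.ofReal_mul hb,
    ← ENNReal.ofReal_div_of_pos (by positivity), div_pow]
  congr 1
  ring

/-! ### Extreme singular values of Gaussian matrices -/

lemma norm_toLp_sq_eq_dotProduct {ι : Type*} [Fintype ι] (v : ι → ℝ) :
    ‖WithLp.toLp 2 v‖ ^ 2 = v ⬝ᵥ v := by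
  rw [EuclideanSpace.norm_sq_eq]
  simp [dotProduct, sq]

lemma dotProduct_le_norm_toLp_mul {ι : Type*} [Fintype ι] (v w : ι → ℝ) :
    v ⬝ᵥ w ≤ ‖WithLp.toLp 2 v‖ * ‖WithLp.toLp 2 w‖ := by
  have h := real_inner_le_norm (WithLp.toLp 2 w) (WithLp.toLp 2 v)
  rw [EuclideanSpace.inner_toLp_toLp] at h
  simpa [mul_comm] using h

lemma norm_toLp_transpose_mulVec_of_mul_transpose {p m : ℕ} {W : Matrix (Fin p) (Fin m) ℝ} {c : ℝ}
    (hc : 0 ≤ c) (hW : W * Wᵀ = c ^ 2 • (1 : Matrix (Fin p) (Fin p) ℝ)) (y : Fin p → ℝ) :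
    ‖WithLp.toLp 2 (Wᵀ *ᵥ y)‖ = c * ‖WithLp.toLp 2 y‖ := by
  rw [← sq_eq_sq₀ (norm_nonneg _) (by positivity), mul_pow, norm_toLp_sq_eq_dotProduct,
    norm_toLp_sq_eq_dotProduct, Matrix.dotProduct_mulVec, Matrix.vecMul_transpose,
    Matrix.mulVec_mulVec, hW, Matrix.smul_mulVec, Matrix.one_mulVec, smul_dotProduct, smul_eq_mul]

lemma norm_toLp_mulVec_le_of_mul_transpose {p m : ℕ} {W : Matrix (Fin p) (Fin m) ℝ} {c : ℝ}
    (hc : 0 ≤ c) (hW : W * Wᵀ = c ^ 2 • (1 : Matrix (Fin p) (Fin p) ℝ)) (z : Fin m → ℝ) :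
    ‖WithLp.toLp 2 (W *ᵥ z)‖ ≤ c * ‖WithLp.toLp 2 z‖ := by
  rcases eq_or_lt_of_le (norm_nonneg (WithLp.toLp 2 (W *ᵥ z))) with h0 | h0
  · rw [← h0]; positivity
  have h1 : (W *ᵥ z) ⬝ᵥ (W *ᵥ z) = (Wᵀ *ᵥ (W *ᵥ z)) ⬝ᵥ z := by
    rw [Matrix.dotProduct_mulVec, Matrix.mulVec_transpose]
  have h2 := dotProduct_le_norm_toLp_mul (Wᵀ *ᵥ (W *ᵥ z)) z
  rw [← h1, ← norm_toLp_sq_eq_dotProduct, norm_toLp_transpose_mulVec_of_mul_transpose hc hW] at h2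
  nlinarith

/-- The matrix whose entries are the coordinates of a vector. -/
def matrixOfVec {m k : ℕ} (g : EuclideanSpace ℝ (Fin m × Fin k)) : Matrix (Fin m) (Fin k) ℝ :=
  Matrix.of fun i j => g (i, j)

/-- The linear map sending a matrix `M`, seen as a vector, to `W M x`. -/
noncomputable def mulMulVecCLM {p m k : ℕ} (W : Matrix (Fin p) (Fin m) ℝ)
    (x : EuclideanSpace ℝ (Fin k)) :
    EuclideanSpace ℝ (Fin m × Fin k) →L[ℝ] EuclideanSpace ℝ (Fin p) :=
  LinearMap.toContinuousLinearMap
    { toFun := fun g => WithLp.toLp 2 (W *ᵥ (matrixOfVec g *ᵥ x.ofLp))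
      map_add' := fun g h => by
        have : matrixOfVec (g + h) = matrixOfVec g + matrixOfVec h := rfl
        rw [this, Matrix.add_mulVec, Matrix.mulVec_add, WithLp.toLp_add]
      map_smul' := fun a g => by
        have : matrixOfVec (a • g) = a • matrixOfVec g := rfl
        rw [this, Matrix.smul_mulVec, Matrix.mulVec_smul, WithLp.toLp_smul, RingHom.id_apply] }

lemma mulMulVecCLM_apply {p m k : ℕ} (W : Matrix (Fin p) (Fin m) ℝ)
    (x : EuclideanSpace ℝ (Fin k)) (g : EuclideanSpace ℝ (Fin m × Fin k)) :
    mulMulVecCLM W x g = WithLp.toLp 2 (W *ᵥ (matrixOfVec g *ᵥ x.ofLp)) := rfl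

lemma adjoint_mulMulVecCLM_apply {p m k : ℕ} (W : Matrix (Fin p) (Fin m) ℝ)
    (x : EuclideanSpace ℝ (Fin k)) (y : EuclideanSpace ℝ (Fin p)) :
    ContinuousLinearMap.adjoint (mulMulVecCLM W x) y
      = WithLp.toLp 2 fun q : Fin m × Fin k => (Wᵀ *ᵥ y.ofLp) q.1 * x q.2 := by
  apply ext_inner_right ℝ
  intro g
  rw [ContinuousLinearMap.adjoint_inner_left, mulMulVecCLM_apply]
  have h1 : inner ℝ y (WithLp.toLp 2 (W *ᵥ (matrixOfVec g *ᵥ x.ofLp)))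
      = y.ofLp ⬝ᵥ (W *ᵥ (matrixOfVec g *ᵥ x.ofLp)) := by
    simp [PiLp.inner_apply, dotProduct, mul_comm]
  rw [h1, Matrix.dotProduct_mulVec, ← Matrix.mulVec_transpose]
  rw [PiLp.inner_apply, Fintype.sum_prod_type, dotProduct]
  refine Finset.sum_congr rfl fun i _ => ?_
  change _ * ∑ j, g (i, j) * x j = _
  rw [Finset.mul_sum]
  refine Finset.sum_congr rfl fun j _ => ?_
  simp
  ring

/-- The adjoint sends `y` to the rank-one matrix `(Wᵀ y) xᵀ`, whose Frobenius norm is a product.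
Hence `W M x` is distributed as `c ‖x‖` times a standard Gaussian vector. -/
lemma norm_adjoint_mulMulVecCLM {p m k : ℕ} {W : Matrix (Fin p) (Fin m) ℝ} {c : ℝ} (hc : 0 ≤ c)
    (hW : W * Wᵀ = c ^ 2 • (1 : Matrix (Fin p) (Fin p) ℝ)) (x : EuclideanSpace ℝ (Fin k))
    (y : EuclideanSpace ℝ (Fin p)) :
    ‖ContinuousLinearMap.adjoint (mulMulVecCLM W x) y‖ = c * ‖x‖ * ‖y‖ := by
  have h := norm_toLp_transpose_mulVec_of_mul_transpose hc hW y.ofLp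
  rw [adjoint_mulMulVecCLM_apply, mul_right_comm]
  change _ = c * ‖WithLp.toLp 2 y.ofLp‖ * ‖x‖
  rw [← h, ← sq_eq_sq₀ (norm_nonneg _) (by positivity), mul_pow, EuclideanSpace.norm_sq_eq,
    EuclideanSpace.norm_sq_eq, EuclideanSpace.norm_sq_eq, Finset.sum_mul_sum,
    Fintype.sum_prod_type]
  simp [mul_pow]

lemma stdGaussian_norm_mulVec_le_le {p m k : ℕ} (hp : 0 < p) {W : Matrix (Fin p) (Fin m) ℝ} {c : ℝ}
    (hc : 0 < c) (hW : W * Wᵀ = c ^ 2 • (1 : Matrix (Fin p) (Fin p) ℝ))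
    {x : EuclideanSpace ℝ (Fin k)} (hx : x ≠ 0) {s : ℝ} (hs : 0 < s) :
    stdGaussian (EuclideanSpace ℝ (Fin m × Fin k))
      {g | ‖WithLp.toLp 2 (W *ᵥ (matrixOfVec g *ᵥ x.ofLp))‖ ≤ s * √p * (c * ‖x‖)}
      ≤ ENNReal.ofReal (2 * s) ^ p := by
  have hx' : 0 < c * ‖x‖ := mul_pos hc (norm_pos_iff.2 hx)
  have hmeas : MeasurableSet {z : EuclideanSpace ℝ (Fin p) | ‖z‖ ≤ s * √p * (c * ‖x‖)} :=
    (isClosed_le continuous_norm continuous_const).measurableSet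
  have h := stdGaussian_map_eq_map_smul (mulMulVecCLM W x) hx'.le
    (norm_adjoint_mulMulVecCLM hc.le hW x)
  have h2 := congrArg (fun μ => μ {z | ‖z‖ ≤ s * √p * (c * ‖x‖)}) h
  simp only at h2
  rw [Measure.map_apply (by fun_prop) hmeas, Measure.map_apply (by fun_prop) hmeas] at h2
  refine h2.le.trans (le_trans (le_of_eq ?_) (stdGaussian_norm_le_le hp hs))
  congr 1
  ext z
  simp only [Set.mem_preimage, Set.mem_ofPred_eq, norm_smul, Real.norm_of_nonneg hx'.le]
  rw [mul_comm _ ‖z‖, mul_le_mul_iff_left₀ hx']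

lemma stdGaussian_le_norm_mulVec_le {m k : ℕ} {x : EuclideanSpace ℝ (Fin k)} (hx : x ≠ 0)
    {s : ℝ} (hs : 0 ≤ s) :
    stdGaussian (EuclideanSpace ℝ (Fin m × Fin k))
      {g | s * ‖x‖ ≤ ‖WithLp.toLp 2 (matrixOfVec g *ᵥ x.ofLp)‖}
      ≤ ENNReal.ofReal (Real.exp (m - s ^ 2 / 4)) := by
  have hx' : 0 < 1 * ‖x‖ := by simpa using hx
  have hmeas : MeasurableSet {z : EuclideanSpace ℝ (Fin m) | s * ‖x‖ ≤ ‖z‖} :=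
    (isClosed_le continuous_const continuous_norm).measurableSet
  have h := stdGaussian_map_eq_map_smul (mulMulVecCLM (m := m) 1 x) hx'.le
    (norm_adjoint_mulMulVecCLM zero_le_one
      (by rw [Matrix.transpose_one, mul_one, one_pow, one_smul]) x)
  have h2 := congrArg (fun μ => μ {z | s * ‖x‖ ≤ ‖z‖}) h
  simp only at h2
  rw [Measure.map_apply (by fun_prop) hmeas, Measure.map_apply (by fun_prop) hmeas] at h2
  have h3 := stdGaussian_le_norm_le (ι := Fin m) hs
  rw [Fintype.card_fin] at h3
  refine le_trans (le_of_eq ?_) (h2.le.trans (le_trans (le_of_eq ?_) h3))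
  · simp [mulMulVecCLM_apply, Set.preimage_ofPred_eq]
  · congr 1
    ext z
    simp only [Set.mem_preimage, Set.mem_ofPred_eq, norm_smul, Real.norm_of_nonneg hx'.le]
    rw [one_mul, mul_comm _ ‖z‖, mul_le_mul_iff_left₀ (by simpa using hx')]

lemma continuous_matrixOfVec_mulVec {m k : ℕ} :
    Continuous fun q : EuclideanSpace ℝ (Fin m × Fin k) × EuclideanSpace ℝ (Fin k) =>
      matrixOfVec q.1 *ᵥ q.2.ofLp := by
  apply Continuous.matrix_mulVec
  · refine continuous_matrix fun i j => ?_
    simp only [matrixOfVec, Matrix.of_apply]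
    fun_prop
  · fun_prop

lemma stdGaussian_exists_lt_norm_mulVec_le {m k : ℕ} (hk : 2 * k ≤ m) (hm : 0 < m) :
    stdGaussian (EuclideanSpace ℝ (Fin m × Fin k))
      {g | ∃ x : EuclideanSpace ℝ (Fin k),
        20 * √m * ‖x‖ < ‖WithLp.toLp 2 (matrixOfVec g *ᵥ x.ofLp)‖}
      ≤ ENNReal.ofReal (Real.exp (-(2 * m))) := by
  have hm' : (0 : ℝ) < m := by exact_mod_cast hm
  have hsm : 0 < √(m : ℝ) := Real.sqrt_pos.2 hm'
  set S : Set (EuclideanSpace ℝ (Fin m × Fin k) × EuclideanSpace ℝ (Fin k)) :=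
    {q | ‖q.2‖ ≤ 5 / 4 ∧ 10 * √m ≤ ‖WithLp.toLp 2 (matrixOfVec q.1 *ᵥ q.2.ofLp)‖} with hS
  have hcont : Continuous fun q : EuclideanSpace ℝ (Fin m × Fin k) × EuclideanSpace ℝ (Fin k) =>
      ‖WithLp.toLp 2 (matrixOfVec q.1 *ᵥ q.2.ofLp)‖ :=
    ((PiLp.continuous_toLp 2 _).comp continuous_matrixOfVec_mulVec).norm
  have hSm : MeasurableSet S :=
    ((isClosed_le continuous_snd.norm continuous_const).inter
      (isClosed_le continuous_const hcont)).measurableSet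
  have key := measure_le_of_closedBall_subset
    (stdGaussian (EuclideanSpace ℝ (Fin m × Fin k))) hSm
    (B := {g | ∃ x : EuclideanSpace ℝ (Fin k),
        20 * √m * ‖x‖ < ‖WithLp.toLp 2 (matrixOfVec g *ᵥ x.ofLp)‖})
    -- The `8` is `10 / (5 / 4)`: points of `S` have norm at most `5 / 4`.
    (ρ := 1 / 4) (R := 5 / 4) (b := Real.exp (m - (8 * √m) ^ 2 / 4))
    (by norm_num) (by norm_num) (by positivity) ?_ (fun _ _ h => h.1) ?_
  · refine key.trans (ENNReal.ofReal_le_ofReal ?_)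
    rw [finrank_euclideanSpace, Fintype.card_fin]
    have h5 : (5 / 4 / (1 / 4) : ℝ) ≤ Real.exp 1 ^ 2 := by
      have := Real.exp_one_gt_d9
      nlinarith
    have h2k : (2 : ℝ) * k ≤ m := by exact_mod_cast hk
    calc (5 / 4 / (1 / 4) : ℝ) ^ k * Real.exp (m - (8 * √m) ^ 2 / 4)
        ≤ (Real.exp 1 ^ 2) ^ k * Real.exp (m - (8 * √m) ^ 2 / 4) := by gcongr
      _ = Real.exp (2 * k + (m - (8 * √m) ^ 2 / 4)) := by
          rw [← pow_mul, ← Real.exp_nat_mul, ← Real.exp_add]; simp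
      _ ≤ _ := by
          apply Real.exp_le_exp.2
          rw [mul_pow, Real.sq_sqrt hm'.le]
          linarith
  · rintro g ⟨x, hx⟩
    set A : EuclideanSpace ℝ (Fin k) →L[ℝ] EuclideanSpace ℝ (Fin m) :=
      LinearMap.toContinuousLinearMap
        ((WithLp.linearEquiv 2 ℝ (Fin m → ℝ)).symm.toLinearMap ∘ₗ (matrixOfVec g).mulVecLin ∘ₗ
          (WithLp.linearEquiv 2 ℝ (Fin k → ℝ)).toLinearMap)
    have hA : ∀ x, A x = WithLp.toLp 2 (matrixOfVec g *ᵥ x.ofLp) := fun x => rfl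
    rw [← hA] at hx
    have hx2 := hx.trans_le (A.le_opNorm x)
    have hs : 20 * √m < ‖A‖ := lt_of_mul_lt_mul_right hx2 (norm_nonneg _)
    have hs0 : 0 < ‖A‖ := by linarith
    -- Moving a nearly extremal `x₀` by at most `1 / 4` keeps the image norm above `‖A‖ / 2 > 10
    -- √m`.
    obtain ⟨x₀, hx₀, hx₀'⟩ := A.exists_lt_apply_of_lt_opNorm (r := 3 / 4 * ‖A‖) (by linarith)
    refine ⟨x₀, fun z hz => ?_⟩
    rw [mem_closedBall_iff_norm] at hz
    refine ⟨?_, ?_⟩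
    · have := norm_sub_norm_le z x₀
      simp only
      linarith
    · have h1 := norm_sub_norm_le (A x₀) (A z)
      rw [← map_sub] at h1
      have h2 := A.le_opNorm (x₀ - z)
      rw [norm_sub_rev] at h2
      have h3 : ‖A‖ * ‖z - x₀‖ ≤ ‖A‖ * (1 / 4) := by gcongr
      change 10 * √m ≤ ‖A z‖
      linarith
  · intro x
    rcases eq_or_ne x 0 with rfl | hx
    · have : {g | (g, (0 : EuclideanSpace ℝ (Fin k))) ∈ S} = ∅ := by
        ext g
        simp only [hS, Set.mem_ofPred_eq, Set.mem_empty_iff_false, iff_false, not_and]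
        intro _
        simpa using hsm
      simp [this]
    · refine (measure_mono fun g hg => ?_).trans
        (stdGaussian_le_norm_mulVec_le hx (s := 8 * √m) (by positivity))
      have h1 := hg.1
      have h2 := hg.2
      simp only [Set.mem_ofPred_eq] at h1 h2 ⊢
      nlinarith

lemma stdGaussian_exists_norm_mulVec_lt_le {p m k : ℕ} (hp : 0 < p) (hpm : p ≤ m)
    {W : Matrix (Fin p) (Fin m) ℝ} {c : ℝ}
    (hc : 0 < c) (hW : W * Wᵀ = c ^ 2 • (1 : Matrix (Fin p) (Fin p) ℝ)) {t : ℝ} (ht : 0 < t)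
    (ht1 : t ≤ 1) :
    stdGaussian (EuclideanSpace ℝ (Fin m × Fin k))
      {g | (∀ x : EuclideanSpace ℝ (Fin k),
          ‖WithLp.toLp 2 (matrixOfVec g *ᵥ x.ofLp)‖ ≤ 20 * √m * ‖x‖) ∧
        ∃ x : EuclideanSpace ℝ (Fin k),
          ‖WithLp.toLp 2 (W *ᵥ (matrixOfVec g *ᵥ x.ofLp))‖ < t * √p * c * ‖x‖}
      ≤ ENNReal.ofReal ((30 * √(m / p) / t) ^ k * (8 * t) ^ p) := by
  have hm' : (0 : ℝ) < m := by exact_mod_cast hp.trans_le hpm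
  have hp' : (0 : ℝ) < p := by exact_mod_cast hp
  have hpm' : (p : ℝ) ≤ m := by exact_mod_cast hpm
  have hsm : 0 < √(m : ℝ) := Real.sqrt_pos.2 hm'
  have hsp : 0 < √(p : ℝ) := Real.sqrt_pos.2 hp'
  have hspm : √(p : ℝ) ≤ √m := Real.sqrt_le_sqrt hpm'
  -- The lower bound on the norm keeps out vectors near `0`, for which the second condition is too
  -- likely; it turns the constant `2 t` into `4 t`, hence the `8 t` in the result.
  set S : Set (EuclideanSpace ℝ (Fin m × Fin k) × EuclideanSpace ℝ (Fin k)) :=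
    {q | (‖q.2‖ ≤ 3 / 2 ∧ 1 / 2 ≤ ‖q.2‖) ∧
      ‖WithLp.toLp 2 (W *ᵥ (matrixOfVec q.1 *ᵥ q.2.ofLp))‖ ≤ 2 * t * √p * c} with hS
  have hcont : Continuous fun q : EuclideanSpace ℝ (Fin m × Fin k) × EuclideanSpace ℝ (Fin k) =>
      ‖WithLp.toLp 2 (W *ᵥ (matrixOfVec q.1 *ᵥ q.2.ofLp))‖ :=
    ((PiLp.continuous_toLp 2 _).comp
      (continuous_const.matrix_mulVec continuous_matrixOfVec_mulVec)).norm
  have hSm : MeasurableSet S :=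
    (((isClosed_le continuous_snd.norm continuous_const).inter
      (isClosed_le continuous_const continuous_snd.norm)).inter
      (isClosed_le hcont continuous_const)).measurableSet
  -- On this scale the norm bound on `M` and `‖W‖ ≤ c` let `W M` vary by at most `t √p c`, so the
  -- threshold only doubles.
  set ρ : ℝ := t * √p / (20 * √m) with hρ
  have hρ0 : 0 < ρ := by positivity
  have hρ1 : ρ ≤ 1 / 2 := by
    rw [hρ, div_le_iff₀ (by positivity)]
    nlinarith
  have key := measure_le_of_closedBall_subset
    (stdGaussian (EuclideanSpace ℝ (Fin m × Fin k))) hSm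
    (B := {g | (∀ x : EuclideanSpace ℝ (Fin k),
          ‖WithLp.toLp 2 (matrixOfVec g *ᵥ x.ofLp)‖ ≤ 20 * √m * ‖x‖) ∧
        ∃ x : EuclideanSpace ℝ (Fin k),
          ‖WithLp.toLp 2 (W *ᵥ (matrixOfVec g *ᵥ x.ofLp))‖ < t * √p * c * ‖x‖})
    (ρ := ρ) (R := 3 / 2) (b := (8 * t) ^ p)
    hρ0 (by norm_num) (by positivity) ?_ (fun _ _ h => h.1.1) ?_
  · refine key.trans (ENNReal.ofReal_le_ofReal (le_of_eq ?_))
    rw [finrank_euclideanSpace, Fintype.card_fin, hρ, Real.sqrt_div hm'.le]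
    congr 2
    field_simp
    norm_num
  · rintro g ⟨hg, x, hx⟩
    have hx0 : 0 < ‖x‖ := by
      rcases eq_or_lt_of_le (norm_nonneg x) with h | h
      · rw [← h, mul_zero] at hx
        exact absurd hx (not_lt.2 (norm_nonneg _))
      · exact h
    have hlin : ∀ (a : ℝ) (z w : EuclideanSpace ℝ (Fin k)),
        WithLp.toLp 2 (W *ᵥ (matrixOfVec g *ᵥ (a • z + w).ofLp))
          = a • WithLp.toLp 2 (W *ᵥ (matrixOfVec g *ᵥ z.ofLp))
            + WithLp.toLp 2 (W *ᵥ (matrixOfVec g *ᵥ w.ofLp)) := by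
      intro a z w
      rw [WithLp.ofLp_add, WithLp.ofLp_smul, Matrix.mulVec_add, Matrix.mulVec_smul,
        Matrix.mulVec_add, Matrix.mulVec_smul, WithLp.toLp_add, WithLp.toLp_smul]
    refine ⟨‖x‖⁻¹ • x, fun z hz => ?_⟩
    have hx1 : ‖‖x‖⁻¹ • x‖ = 1 := by
      rw [norm_smul, norm_inv, norm_norm, inv_mul_cancel₀ hx0.ne']
    rw [mem_closedBall_iff_norm] at hz
    refine ⟨⟨?_, ?_⟩, ?_⟩
    · have := norm_sub_norm_le z (‖x‖⁻¹ • x)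
      simp only
      linarith
    · have := norm_sub_norm_le (‖x‖⁻¹ • x) z
      rw [norm_sub_rev] at this
      simp only
      linarith
    · have hz2 : z = ‖x‖⁻¹ • x + (z - ‖x‖⁻¹ • x) := by abel
      have h1 := norm_toLp_mulVec_le_of_mul_transpose hc.le hW
        (matrixOfVec g *ᵥ (z - ‖x‖⁻¹ • x).ofLp)
      have h2 := hg (z - ‖x‖⁻¹ • x)
      have h3 : 20 * √m * ‖z - ‖x‖⁻¹ • x‖ ≤ 20 * √m * ρ := by gcongr
      have h4 : 20 * √m * ρ = t * √p := by rw [hρ]; field_simp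
      have h5 : ‖‖x‖⁻¹ • WithLp.toLp 2 (W *ᵥ (matrixOfVec g *ᵥ x.ofLp))‖ ≤ t * √p * c := by
        rw [norm_smul, norm_inv, norm_norm, inv_mul_le_iff₀ hx0]
        linarith
      have h6 : c * ‖WithLp.toLp 2 (matrixOfVec g *ᵥ (z - ‖x‖⁻¹ • x).ofLp)‖ ≤ c * (t * √p) := by
        gcongr
        linarith
      change ‖WithLp.toLp 2 (W *ᵥ (matrixOfVec g *ᵥ z.ofLp))‖ ≤ _
      rw [hz2, hlin]
      refine (norm_add_le _ _).trans ?_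
      linarith
  · intro x
    by_cases hx : 1 / 2 ≤ ‖x‖
    · have hx0 : x ≠ 0 := by
        rintro rfl
        norm_num at hx
      have := stdGaussian_norm_mulVec_le_le (m := m) hp hc hW hx0 (s := 4 * t) (by positivity)
      rw [← ENNReal.ofReal_pow (by positivity),
        show 2 * (4 * t) = 8 * t by ring] at this
      refine (measure_mono fun g hg => ?_).trans this
      have h2 := hg.2
      simp only [Set.mem_ofPred_eq] at h2 ⊢
      refine h2.trans ?_
      have : 4 * t * √p * c * (1 / 2) ≤ 4 * t * √p * c * ‖x‖ := by gcongr
      linarith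
    · have : {g | (g, x) ∈ S} = ∅ := by
        ext g
        simp only [hS, Set.mem_ofPred_eq, Set.mem_empty_iff_false, iff_false]
        tauto
      simp [this]

/-! ### Noise-shaping quantization and the dual frame -/

/-- The matrix whose `i`-th row carries the weights `w` at the positions `e (i, ·)`. -/
noncomputable def blockMatrix {p n m : ℕ} (e : Fin p × Fin n → Fin m) (w : Fin n → ℝ) :
    Matrix (Fin p) (Fin m) ℝ :=
  Matrix.of fun i j => ∑ r, if e (i, r) = j then w r else 0

lemma blockMatrix_mulVec {p n m : ℕ} (e : Fin p × Fin n → Fin m) (w : Fin n → ℝ) (y : Fin m → ℝ)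
    (i : Fin p) : (blockMatrix e w *ᵥ y) i = ∑ r, w r * y (e (i, r)) := by
  simp only [Matrix.mulVec, dotProduct, blockMatrix, Matrix.of_apply, Finset.sum_mul]
  rw [Finset.sum_comm]
  refine Finset.sum_congr rfl fun r _ => ?_
  simp

/-- Injectivity of `e` gives the rows disjoint supports, and all carry the same weights. -/
lemma blockMatrix_mul_transpose {p n m : ℕ} {e : Fin p × Fin n → Fin m}
    (he : Function.Injective e) (w : Fin n → ℝ) :
    blockMatrix e w * (blockMatrix e w)ᵀ
      = √(∑ r, w r ^ 2) ^ 2 • (1 : Matrix (Fin p) (Fin p) ℝ) := by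
  rw [Real.sq_sqrt (Finset.sum_nonneg fun _ _ => sq_nonneg _)]
  ext i i'
  have h : (blockMatrix e w * (blockMatrix e w)ᵀ) i i'
      = (blockMatrix e w *ᵥ fun j => blockMatrix e w i' j) i := rfl
  rw [h, blockMatrix_mulVec]
  simp only [blockMatrix, Matrix.of_apply, he.eq_iff, Prod.mk.injEq, Matrix.smul_apply,
    Matrix.one_apply, smul_eq_mul]
  by_cases hi : i = i'
  · subst hi
    simp [sq]
  · simp [hi, Ne.symm hi]

/-- The `L` midpoints of a subdivision of `[-L δ, L δ]` into intervals of length `2 δ`. -/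
noncomputable def uniformAlphabet (L : ℕ) (δ : ℝ) : Finset ℝ :=
  (Finset.range L).image fun i : ℕ => δ * (2 * i + 1 - L)

lemma card_uniformAlphabet (L : ℕ) {δ : ℝ} (hδ : 0 < δ) : (uniformAlphabet L δ).card = L := by
  rw [uniformAlphabet, Finset.card_image_of_injective, Finset.card_range]
  intro i j hij
  have h := mul_left_cancel₀ hδ.ne' hij
  have : (i : ℝ) = j := by linarith
  exact_mod_cast this

lemma exists_mem_uniformAlphabet_abs_sub_le {L : ℕ} (hL : 0 < L) {δ : ℝ} (hδ : 0 < δ) {z : ℝ}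
    (hz : |z| ≤ L * δ) : ∃ a ∈ uniformAlphabet L δ, |z - a| ≤ δ := by
  obtain ⟨hz1, hz2⟩ := abs_le.1 hz
  have key : ∃ i < L, (i : ℝ) ≤ (z / δ + L) / 2 ∧ (z / δ + L) / 2 ≤ i + 1 := by
    have h1 : -(L : ℝ) ≤ z / δ := by rw [le_div_iff₀ hδ]; linarith
    have h2 : z / δ ≤ L := by rwa [div_le_iff₀ hδ]
    rcases lt_or_eq_of_le h2 with h | h
    · have h0 : 0 ≤ (z / δ + L) / 2 := by linarith
      refine ⟨⌊(z / δ + L) / 2⌋₊, ?_, Nat.floor_le h0, (Nat.lt_floor_add_one _).le⟩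
      rw [Nat.floor_lt h0]
      linarith
    -- At the right endpoint the floor would be `L`, one past the last index.
    · refine ⟨L - 1, by omega, ?_⟩
      rw [h, Nat.cast_sub hL]
      norm_num
  obtain ⟨i, hi, h1, h2⟩ := key
  refine ⟨δ * (2 * i + 1 - L), Finset.mem_image.2 ⟨i, Finset.mem_range.2 hi, rfl⟩, ?_⟩
  have h3 : z - δ * (2 * i + 1 - L) = δ * (z / δ + L - 2 * i - 1) := by
    field_simp
    ring
  rw [h3, abs_mul, abs_of_pos hδ]
  have : |z / δ + L - 2 * i - 1| ≤ 1 := by rw [abs_le]; constructor <;> linarith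
  nlinarith

/-- Greedy noise shaping keeps the state variable bounded. -/
lemma exists_greedy_quantization {A : Set ℝ} {K β δ : ℝ} (hβ : 0 ≤ β)
    (hA : ∀ z, |z| ≤ K + β * δ → ∃ a ∈ A, |z - a| ≤ δ) (hδ : 0 ≤ δ) (n : ℕ) (y : Fin n → ℝ)
    (hy : ∀ r, |y r| ≤ K) :
    ∃ q : Fin n → ℝ, (∀ r, q r ∈ A) ∧ |∑ r : Fin n, β ^ (n - 1 - (r : ℕ)) * (y r - q r)| ≤ δ := by
  induction n with
  | zero => exact ⟨fun r => r.elim0, fun r => r.elim0, by simpa using hδ⟩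
  | succ n ih =>
    obtain ⟨q, hq, hu⟩ := ih (fun r => y r.castSucc) (fun r => hy _)
    set u := ∑ r : Fin n, β ^ (n - 1 - (r : ℕ)) * (y r.castSucc - q r) with hu'
    -- The state obeys `u' = β u + y - a`; as `|u| ≤ δ`, the value to be rounded stays within the
    -- range covered by `A`.
    obtain ⟨a, ha, hza⟩ := hA (y (Fin.last n) + β * u) (by
      refine (abs_add_le _ _).trans (add_le_add (hy _) ?_)
      rw [abs_mul, abs_of_nonneg hβ]
      gcongr)
    refine ⟨Fin.snoc (α := fun _ => ℝ) q a, fun r => ?_, ?_⟩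
    · refine Fin.lastCases ?_ (fun r => ?_) r
      · simpa using ha
      · simpa using hq r
    · refine (le_of_eq ?_).trans hza
      congr 1
      rw [Fin.sum_univ_castSucc, hu', Finset.mul_sum]
      simp only [Fin.val_castSucc, Fin.snoc_castSucc, Fin.val_last, Fin.snoc_last]
      have : ∀ r : Fin n, β ^ (n + 1 - 1 - (r : ℕ)) * (y r.castSucc - q r)
          = β * (β ^ (n - 1 - (r : ℕ)) * (y r.castSucc - q r)) := by
        intro r
        rw [show n + 1 - 1 - (r : ℕ) = (n - 1 - (r : ℕ)) + 1 by omega, pow_succ]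
        ring
      simp only [this]
      simp
      ring

/-- The pseudo-inverse `(Mᵀ M)⁻¹ Mᵀ` works: for `a = N z`, the vector `M a` is the orthogonal
projection of `z`, so `σ ‖a‖ ≤ ‖M a‖ ≤ ‖z‖`. -/
lemma exists_left_inverse_norm_le {p k : ℕ} (M : Matrix (Fin p) (Fin k) ℝ) {σ : ℝ} (hσ : 0 < σ)
    (hM : ∀ v : Fin k → ℝ, σ * ‖WithLp.toLp 2 v‖ ≤ ‖WithLp.toLp 2 (M *ᵥ v)‖) :
    ∃ N : Matrix (Fin k) (Fin p) ℝ, N * M = 1 ∧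
      ∀ z : Fin p → ℝ, σ * ‖WithLp.toLp 2 (N *ᵥ z)‖ ≤ ‖WithLp.toLp 2 z‖ := by
  have hdot : ∀ v : Fin k → ℝ, v ⬝ᵥ ((Mᵀ * M) *ᵥ v) = ‖WithLp.toLp 2 (M *ᵥ v)‖ ^ 2 := by
    intro v
    rw [norm_toLp_sq_eq_dotProduct, ← Matrix.mulVec_mulVec, Matrix.dotProduct_mulVec,
      Matrix.vecMul_transpose]
  have hunit : IsUnit (Mᵀ * M) := by
    rw [← Matrix.mulVec_injective_iff_isUnit]
    apply (injective_iff_map_eq_zero (Mᵀ * M).mulVecLin).2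
    intro v hv
    have h1 := hdot v
    rw [Matrix.mulVecLin_apply] at hv
    rw [hv, dotProduct_zero] at h1
    have h2 : ‖WithLp.toLp 2 (M *ᵥ v)‖ = 0 := by
      exact pow_eq_zero_iff (two_ne_zero) |>.1 h1.symm
    have h3 := hM v
    rw [h2] at h3
    have h4 : ‖WithLp.toLp 2 v‖ = 0 := by
      apply le_antisymm _ (norm_nonneg _)
      exact le_of_mul_le_mul_left (by simpa using h3) hσ
    simpa using h4
  have hdet := (Matrix.isUnit_iff_isUnit_det _).1 hunit
  refine ⟨(Mᵀ * M)⁻¹ * Mᵀ, by rw [Matrix.mul_assoc, Matrix.nonsing_inv_mul _ hdet], fun z => ?_⟩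
  set a := ((Mᵀ * M)⁻¹ * Mᵀ) *ᵥ z with ha
  have h1 : (Mᵀ * M) *ᵥ a = Mᵀ *ᵥ z := by
    rw [ha, Matrix.mulVec_mulVec, ← Matrix.mul_assoc, Matrix.mul_nonsing_inv _ hdet,
      Matrix.one_mul]
  have h2 := hdot a
  rw [h1, Matrix.dotProduct_mulVec, Matrix.vecMul_transpose] at h2
  have h3 := dotProduct_le_norm_toLp_mul (M *ᵥ a) z
  rw [h2] at h3
  refine (hM a).trans ?_
  rcases eq_or_lt_of_le (norm_nonneg (WithLp.toLp 2 (M *ᵥ a))) with h0 | h0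
  · rw [← h0]; exact norm_nonneg _
  · nlinarith

lemma analysisDistortionLevels_le_of_blockMatrix {p n m k : ℕ} {e : Fin p × Fin n → Fin m}
    (he : Function.Injective e) (E : Matrix (Fin m) (Fin k) ℝ) {K β δ σ : ℝ} {L : ℕ} (hL : 0 < L)
    (hK0 : 0 ≤ K) (hβ : 0 ≤ β) (hδ : 0 < δ) (hσ : 0 < σ) (hK : K + β * δ ≤ L * δ)
    (hE : ∀ x : EuclideanSpace ℝ (Fin k), ‖WithLp.toLp 2 (E *ᵥ x.ofLp)‖ ≤ K * ‖x‖)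
    (hEσ : ∀ x : EuclideanSpace ℝ (Fin k), σ * ‖x‖ ≤ ‖WithLp.toLp 2
      (blockMatrix e (fun r : Fin n => β ^ (n - 1 - (r : ℕ))) *ᵥ (E *ᵥ x.ofLp))‖) :
    analysisDistortionLevels E L ≤ ENNReal.ofReal (√p * δ / σ) := by
  set W := blockMatrix e (fun r : Fin n => β ^ (n - 1 - (r : ℕ))) with hW
  set A := uniformAlphabet L δ with hAdef
  have hcover : ∀ z, |z| ≤ L * δ → ∃ a ∈ A, |z - a| ≤ δ := fun z hz =>
    exists_mem_uniformAlphabet_abs_sub_le hL hδ hz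
  obtain ⟨a₀, ha₀, -⟩ := hcover 0 (by rw [abs_zero]; positivity)
  obtain ⟨N, hN, hNb⟩ := exists_left_inverse_norm_le (W * E) hσ (fun v => by
    rw [← Matrix.mulVec_mulVec]; exact hEσ (WithLp.toLp 2 v))
  refine (iInf₂_le A (card_uniformAlphabet L hδ)).trans ?_
  refine (iInf₂_le (N * W) (by rw [Matrix.mul_assoc, hN])).trans ?_
  refine iSup₂_le fun x hx => ?_
  rw [mem_closedBall_zero_iff] at hx
  have hy : ∀ j, |(E *ᵥ x.ofLp) j| ≤ K := by
    intro j
    have h1 := PiLp.norm_apply_le (WithLp.toLp 2 (E *ᵥ x.ofLp)) j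
    exact h1.trans ((hE x).trans (mul_le_of_le_one_right hK0 hx))
  choose q hqA hq using fun i : Fin p => exists_greedy_quantization (A := (A : Set ℝ)) hβ
    (fun z hz => hcover z (hz.trans hK)) hδ.le n (fun r => (E *ᵥ x.ofLp) (e (i, r))) (fun r => hy _)
  -- Coordinates outside the blocks have weight zero in `W`, so any letter `a₀` will do there.
  set Q : Fin m → ℝ := Function.extend e (fun s => q s.1 s.2) (fun _ => a₀) with hQ
  have hQe : ∀ i r, Q (e (i, r)) = q i r := fun i r => he.extend_apply _ _ _
  have hQA : ∀ j, Q j ∈ A := by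
    intro j
    by_cases hj : ∃ s, e s = j
    · obtain ⟨⟨i, r⟩, rfl⟩ := hj
      rw [hQe]
      exact hqA i r
    · rw [hQ, Function.extend_apply' _ _ _ hj]
      exact ha₀
  refine (iInf₂_le Q hQA).trans ?_
  rw [← ofReal_norm]
  apply ENNReal.ofReal_le_ofReal
  have hdiff : x - WithLp.toLp 2 ((N * W) *ᵥ Q)
      = WithLp.toLp 2 (N *ᵥ (W *ᵥ (E *ᵥ x.ofLp - Q))) := by
    have h1 : x.ofLp = N *ᵥ (W *ᵥ (E *ᵥ x.ofLp)) := by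
      rw [Matrix.mulVec_mulVec, Matrix.mulVec_mulVec, Matrix.mul_assoc, hN,
        Matrix.one_mulVec]
    rw [Matrix.mulVec_sub, Matrix.mulVec_sub, ← h1, WithLp.toLp_sub, Matrix.mulVec_mulVec]
  rw [hdiff, le_div_iff₀ hσ, mul_comm]
  refine (hNb _).trans ?_
  refine abs_le_of_sq_le_sq' ?_ (by positivity) |>.2
  rw [EuclideanSpace.norm_sq_eq, mul_pow, Real.sq_sqrt (by positivity)]
  calc ∑ i, ‖(W *ᵥ (E *ᵥ x.ofLp - Q)) i‖ ^ 2 ≤ ∑ _i : Fin p, δ ^ 2 := by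
        refine Finset.sum_le_sum fun i _ => ?_
        rw [hW, blockMatrix_mulVec]
        simp only [Pi.sub_apply, hQe]
        have := hq i
        rw [← Real.norm_eq_abs] at this
        gcongr
    _ = _ := by simp

/-! ### Passage to the probability space and numerical estimates -/

lemma map_toLp_eq_stdGaussian_of_isStandardGaussianMatrix {Ω : Type*} [MeasurableSpace Ω]
    {P : Measure Ω} [IsProbabilityMeasure P] {m k : ℕ} {E : Ω → Matrix (Fin m) (Fin k) ℝ}
    (hE : IsStandardGaussianMatrix E P) :
    AEMeasurable (fun ω => WithLp.toLp 2 fun q : Fin m × Fin k => E ω q.1 q.2) P ∧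
      P.map (fun ω => WithLp.toLp 2 fun q : Fin m × Fin k => E ω q.1 q.2)
        = stdGaussian (EuclideanSpace ℝ (Fin m × Fin k)) := by
  have hm : ∀ q : Fin m × Fin k, AEMeasurable (fun ω => E ω q.1 q.2) P := fun q =>
    (hE.hasLaw q.1 q.2).aemeasurable
  have hm' : AEMeasurable (fun ω (q : Fin m × Fin k) => E ω q.1 q.2) P :=
    aemeasurable_pi_lambda _ hm
  have hmap := (iIndepFun_iff_map_fun_eq_pi_map hm).1 hE.indep
  simp_rw [fun q : Fin m × Fin k => (hE.hasLaw q.1 q.2).map_eq] at hmap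
  have hL : Measurable (WithLp.toLp 2 : (Fin m × Fin k → ℝ) → _) := by fun_prop
  refine ⟨hL.comp_aemeasurable hm', ?_⟩
  rw [← map_pi_eq_stdGaussian, ← hmap, AEMeasurable.map_map_of_aemeasurable hL.aemeasurable hm']
  rfl

/-- Measurable hulls are taken both in `H` and in `Ω`, because `B` is not assumed measurable and `X`
is only almost everywhere measurable. -/
lemma exists_measurableSet_compl_of_map {Ω H : Type*} [MeasurableSpace Ω] [MeasurableSpace H]
    {P : Measure Ω} [IsProbabilityMeasure P] {X : Ω → H} (hX : AEMeasurable X P) {B : Set H}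
    {b : ℝ} (hb : 0 ≤ b) (hB : P.map X B ≤ ENNReal.ofReal b) :
    ∃ G : Set Ω, MeasurableSet G ∧ 1 - b ≤ P.real G ∧ ∀ ω ∈ G, X ω ∉ B := by
  set B' := toMeasurable (P.map X) B
  refine ⟨(toMeasurable P (X ⁻¹' B'))ᶜ, (measurableSet_toMeasurable _ _).compl, ?_, ?_⟩
  · rw [probReal_compl_eq_one_sub (measurableSet_toMeasurable _ _)]
    have h1 : P (toMeasurable P (X ⁻¹' B')) ≤ ENNReal.ofReal b := by
      rwa [measure_toMeasurable, ← Measure.map_apply_of_aemeasurable hX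
        (measurableSet_toMeasurable _ _), measure_toMeasurable]
    have h2 : P.real (toMeasurable P (X ⁻¹' B')) ≤ b := ENNReal.toReal_le_of_le_ofReal hb h1
    linarith
  · intro ω hω hωB
    exact hω (subset_toMeasurable _ _ (subset_toMeasurable (P.map X) B hωB))

/-- Since `a ≥ 2`, each term satisfies `j ^ (-a) ≤ 4 * 2 ^ (-a) / j ^ 2`, and `4 (π ^ 2 / 6 - 1) ≤
3`. -/
lemma tsum_ofReal_rpow_neg_le {a : ℝ} (ha : 2 ≤ a) :
    ∑' i : ℕ, ENNReal.ofReal (((i + 2 : ℕ) : ℝ) ^ (-a)) ≤ ENNReal.ofReal (3 * 2 ^ (-a)) := by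
  have hsum : HasSum (fun i : ℕ => 1 / ((i + 2 : ℕ) : ℝ) ^ 2) (Real.pi ^ 2 / 6 - 1) := by
    have h := (hasSum_nat_add_iff' 2).2 hasSum_zeta_two
    simpa [Finset.sum_range_succ] using h
  have hle : ∀ i : ℕ, ((i + 2 : ℕ) : ℝ) ^ (-a)
      ≤ (2 : ℝ) ^ (-a) * 4 * (1 / ((i + 2 : ℕ) : ℝ) ^ 2) := by
    intro i
    have hi : (0 : ℝ) < ((i + 2 : ℕ) : ℝ) := by positivity
    have hi2 : (2 : ℝ) ≤ ((i + 2 : ℕ) : ℝ) := by push_cast; linarith [Nat.cast_nonneg (α := ℝ) i]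
    have h1 : ∀ x : ℝ, 0 < x → x ^ (-a) = x ^ (2 - a) * (1 / x ^ 2) := by
      intro x hx
      rw [← Real.rpow_natCast, one_div, ← Real.rpow_neg hx.le, ← Real.rpow_add hx]
      congr 1
      push_cast
      ring
    have h2 : ((i + 2 : ℕ) : ℝ) ^ (2 - a) ≤ 2 ^ (2 - a) :=
      Real.rpow_le_rpow_of_nonpos two_pos hi2 (by linarith)
    rw [h1 _ hi, h1 2 two_pos]
    have : (2 : ℝ) ^ (2 - a) * (1 / 2 ^ 2) * 4 = 2 ^ (2 - a) := by ring
    rw [this]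
    gcongr
  calc ∑' i : ℕ, ENNReal.ofReal (((i + 2 : ℕ) : ℝ) ^ (-a))
      ≤ ∑' i : ℕ, ENNReal.ofReal ((2 : ℝ) ^ (-a) * 4 * (1 / ((i + 2 : ℕ) : ℝ) ^ 2)) :=
        ENNReal.tsum_le_tsum fun i => ENNReal.ofReal_le_ofReal (hle i)
    _ = ENNReal.ofReal ((2 : ℝ) ^ (-a) * 4 * (Real.pi ^ 2 / 6 - 1)) := by
        rw [← (hsum.mul_left _).tsum_eq, ENNReal.ofReal_tsum_of_nonneg (fun i => by positivity)
          (hsum.mul_left _).summable]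
    _ ≤ _ := by
        apply ENNReal.ofReal_le_ofReal
        have h2 : (0 : ℝ) < 2 ^ (-a) := by positivity
        have h3 : 4 * (Real.pi ^ 2 / 6 - 1) ≤ 3 := by
          have := Real.pi_lt_d2
          have := Real.pi_pos
          nlinarith
        nlinarith

/-- As `(1 + 1 / n) ^ (n - 1) ≤ e`, lowering the base from `L` to `β = L n / (n + 1)` for stability
costs only a factor `e`. -/
lemma pow_div_exp_one_le_pow {x : ℝ} (hx : 0 ≤ x) {n : ℕ} (hn : 1 ≤ n) :
    x ^ (n - 1) / Real.exp 1 ≤ (x * n / (n + 1)) ^ (n - 1) := by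
  have hn0 : (0 : ℝ) < n := by exact_mod_cast hn
  have h1 : (((n : ℝ) + 1) / n) ^ (n - 1) ≤ Real.exp 1 := by
    calc (((n : ℝ) + 1) / n) ^ (n - 1) ≤ (((n : ℝ) + 1) / n) ^ n := by
          apply pow_le_pow_right₀ _ (Nat.sub_le _ _)
          rw [le_div_iff₀ hn0]
          linarith
      _ ≤ (Real.exp (1 / n)) ^ n := by
          gcongr
          have := Real.add_one_le_exp (1 / n : ℝ)
          have h2 : ((n : ℝ) + 1) / n = 1 / n + 1 := by field_simp; ring
          rwa [h2]
      _ = Real.exp 1 := by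
          rw [← Real.exp_nat_mul]
          congr 1
          field_simp
  have h2 : x = (x * n / (n + 1)) * ((n + 1) / n) := by field_simp
  rw [div_le_iff₀ (Real.exp_pos 1)]
  calc x ^ (n - 1) = (x * n / (n + 1)) ^ (n - 1) * (((n : ℝ) + 1) / n) ^ (n - 1) := by
        rw [← mul_pow, ← h2]
    _ ≤ _ := by gcongr

/-- The failure probability for `L` levels, in terms of the oversampling ratio. -/
lemma small_ball_bound_le_rpow {η : ℝ} (hη : 0 < η) {m k p : ℕ} (hk : 0 < k)
    (hkp : (k : ℝ) + η * k / 4 ≤ p) (hp2 : p ≤ 2 * k) (hm : 2 * k ≤ m)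
    (hr : 1000 * Real.log ((m : ℝ) / k) ≤ η ^ 2 * (m / k)) {L : ℕ} (hL : 2 ≤ L) :
    (30 * √((m : ℝ) / p) / (L : ℝ) ^ (-(η * (m / k) / 4))) ^ k
        * (8 * (L : ℝ) ^ (-(η * (m / k) / 4))) ^ p
      ≤ (L : ℝ) ^ (-(η ^ 2 * m / 40)) := by
  have hk' : (0 : ℝ) < k := by exact_mod_cast hk
  have hm2 : (2 : ℝ) * k ≤ m := by exact_mod_cast hm
  have hp2' : (p : ℝ) ≤ 2 * k := by exact_mod_cast hp2
  have hm' : (0 : ℝ) < m := by linarith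
  have hkp' : (k : ℝ) ≤ p := by nlinarith [mul_pos hη hk']
  have hp' : (0 : ℝ) < p := by linarith
  set r : ℝ := m / k with hrdef
  have hmr : (m : ℝ) = r * k := by rw [hrdef]; field_simp
  have hr2 : 2 ≤ r := by rw [hrdef, le_div_iff₀ hk']; exact hm2
  have hr0 : 0 < r := by linarith
  have hL2 : (2 : ℝ) ≤ L := by exact_mod_cast hL
  have hL0 : (0 : ℝ) < L := by linarith
  have hl2 := Real.log_two_gt_d9
  have hlogr : Real.log 2 ≤ Real.log r := Real.log_le_log two_pos hr2
  have hlogL : Real.log 2 ≤ Real.log L := Real.log_le_log two_pos hL2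
  have h30 : (30 : ℝ) ≤ Real.exp 4 := by
    have h := Real.exp_one_gt_d9
    have : Real.exp 4 = Real.exp 1 ^ 4 := by rw [← Real.exp_nat_mul]; norm_num
    rw [this]
    calc (30 : ℝ) ≤ 2.7 ^ 4 := by norm_num
      _ ≤ _ := by gcongr; linarith
  have h8 : (8 : ℝ) ≤ Real.exp 3 := by
    have h := Real.exp_one_gt_d9
    have : Real.exp 3 = Real.exp 1 ^ 3 := by rw [← Real.exp_nat_mul]; norm_num
    rw [this]
    calc (8 : ℝ) ≤ 2.7 ^ 3 := by norm_num
      _ ≤ _ := by gcongr; linarith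
  have hsq : √((m : ℝ) / p) ≤ Real.exp (Real.log r / 2) := by
    rw [Real.sqrt_le_left (Real.exp_pos _).le, ← Real.exp_nat_mul]
    have : ((2 : ℕ) : ℝ) * (Real.log r / 2) = Real.log r := by push_cast; ring
    rw [this, Real.exp_log hr0]
    exact div_le_div_of_nonneg_left hm'.le hk' hkp'
  set s : ℝ := η * r / 4 with hs
  have ht : (L : ℝ) ^ (-s) = Real.exp (-(Real.log L * s)) := by
    rw [Real.rpow_def_of_pos hL0]; congr 1; ring
  rw [ht, Real.rpow_def_of_pos hL0]
  have h1 : 30 * √((m : ℝ) / p) / Real.exp (-(Real.log L * s))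
      ≤ Real.exp (4 + Real.log r / 2 + Real.log L * s) := by
    rw [div_le_iff₀ (Real.exp_pos _), ← Real.exp_add]
    calc 30 * √((m : ℝ) / p) ≤ Real.exp 4 * Real.exp (Real.log r / 2) := by gcongr
      _ = _ := by rw [← Real.exp_add]; congr 1; ring
  have h2 : 8 * Real.exp (-(Real.log L * s)) ≤ Real.exp (3 - Real.log L * s) := by
    rw [sub_eq_add_neg, Real.exp_add]
    gcongr
  calc (30 * √((m : ℝ) / p) / Real.exp (-(Real.log L * s))) ^ k
        * (8 * Real.exp (-(Real.log L * s))) ^ p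
      ≤ Real.exp (4 + Real.log r / 2 + Real.log L * s) ^ k * Real.exp (3 - Real.log L * s) ^ p := by
        gcongr
    _ = Real.exp (k * (4 + Real.log r / 2) + 3 * p - Real.log L * s * (p - k)) := by
        rw [← Real.exp_nat_mul, ← Real.exp_nat_mul, ← Real.exp_add]
        congr 1
        ring
    _ ≤ _ := by
        apply Real.exp_le_exp.2
        have hs0 : 0 ≤ Real.log L * s := by
          have : 0 ≤ Real.log L := by linarith
          positivity
        -- The excess `p - k ≥ η k / 4` gains `η² m log L / 16` in the exponent. Of this, `η² m log
        -- L / 40` is kept; the rest absorbs `4 k + 3 p + k log r / 2` by `hr`.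
        have h3 : Real.log L * s * (η * k / 4) ≤ Real.log L * s * (p - k) := by
          gcongr
          linarith
        have h4 : Real.log L * s * (η * k / 4) = Real.log L * (η ^ 2 * r * k / 16) := by
          rw [hs]; ring
        have h5 : Real.log L * -(η ^ 2 * m / 40) = - (Real.log L * (η ^ 2 * r * k / 40)) := by
          rw [hmr]; ring
        have h6 : 1000 * Real.log r * k ≤ η ^ 2 * r * k := by gcongr
        have h7 : (0.69 : ℝ) * (1000 * Real.log r * k) ≤ Real.log L * (η ^ 2 * r * k) := by
          have : 0 ≤ Real.log r := by linarith
          gcongr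
          linarith
        have h8 : k * 0.69 ≤ k * Real.log r := by gcongr; linarith
        rw [h5]
        linarith

/-! ### Choice of parameters and conclusion -/

lemma analysisDistortionLevels_lt {η : ℝ} (hη : 0 < η) (hη1 : η < 1 / 2) {m k p n : ℕ} (hk : 0 < k)
    (hkp : k ≤ p) (hp : (p : ℝ) ≤ k + η * k / 2) (hn1 : 1 ≤ n) (hpn : p * n ≤ m)
    (hn : m < (n + 1) * p) (hr : 16 ≤ η * ((m : ℝ) / k)) {e : Fin p × Fin n → Fin m}
    (he : Function.Injective e) {E : Matrix (Fin m) (Fin k) ℝ} {L : ℕ} (hL : 2 ≤ L)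
    (hE : ∀ x : EuclideanSpace ℝ (Fin k), ‖WithLp.toLp 2 (E *ᵥ x.ofLp)‖ ≤ 20 * √m * ‖x‖)
    (hEσ : ∀ x : EuclideanSpace ℝ (Fin k),
      (L : ℝ) ^ (-(η * (m / k) / 4)) * √p
        * √(∑ r : Fin n, ((L * n / (n + 1) : ℝ) ^ (n - 1 - (r : ℕ))) ^ 2) * ‖x‖
      ≤ ‖WithLp.toLp 2 (blockMatrix e (fun r : Fin n => (L * n / (n + 1) : ℝ) ^ (n - 1 - (r : ℕ)))
          *ᵥ (E *ᵥ x.ofLp))‖) :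
    analysisDistortionLevels E L <
      ENNReal.ofReal (16 * Real.exp 1 * (m : ℝ) ^ (3 / 2 : ℝ) * (k : ℝ)⁻¹ *
        (L : ℝ) ^ (-((1 - η) * ((m : ℝ) / k)))) := by
  have hk' : (0 : ℝ) < k := by exact_mod_cast hk
  have hkp' : (k : ℝ) ≤ p := by exact_mod_cast hkp
  have hp' : (0 : ℝ) < p := by linarith
  have hn' : (1 : ℝ) ≤ n := by exact_mod_cast hn1
  have hpn' : (p : ℝ) * n ≤ m := by exact_mod_cast hpn
  have hnm' : (m : ℝ) < (n + 1) * p := by exact_mod_cast hn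
  have hm' : (0 : ℝ) < m := by nlinarith
  have hL2 : (2 : ℝ) ≤ L := by exact_mod_cast hL
  have hL0 : (0 : ℝ) < L := by linarith
  set r : ℝ := m / k with hrdef
  have hmr : (m : ℝ) = r * k := by rw [hrdef]; field_simp
  have hr0 : 0 < r := by positivity
  have hnr : (n : ℝ) ≤ r := by rw [hrdef, le_div_iff₀ hk']; nlinarith
  set β : ℝ := L * n / (n + 1) with hβ
  set s : ℝ := η * r / 4 with hs
  set c : ℝ := √(∑ i : Fin n, (β ^ (n - 1 - (i : ℕ))) ^ 2) with hc
  have hβ0 : 0 < β := by positivity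
  have hcβ : β ^ (n - 1) ≤ c := by
    apply Real.le_sqrt_of_sq_le
    have := Finset.single_le_sum (f := fun i : Fin n => (β ^ (n - 1 - (i : ℕ))) ^ 2)
      (fun i _ => sq_nonneg _) (Finset.mem_univ ⟨0, hn1⟩)
    simpa using this
  have hc0 : 0 < c := lt_of_lt_of_le (by positivity) hcβ
  have ht0 : 0 < (L : ℝ) ^ (-s) := by positivity
  have hsm : 0 < √(m : ℝ) := Real.sqrt_pos.2 hm'
  -- With `δ = K (n + 1) / L` the stability condition `K + β δ ≤ L δ` holds with equality.
  have hK : ∀ a l x : ℝ, 0 < x + 1 → 0 < l →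
      a + l * x / (x + 1) * (a * (x + 1) / l) = l * (a * (x + 1) / l) := by
    intro a l x hx hl
    field_simp
    ring
  have hD := analysisDistortionLevels_le_of_blockMatrix he E (K := 20 * √m) (β := β)
    (δ := 20 * √m * (n + 1) / L) (σ := (L : ℝ) ^ (-s) * √p * c) (L := L) (by omega)
    (by positivity) hβ0.le (by positivity) (mul_pos (mul_pos ht0 (Real.sqrt_pos.2 hp')) hc0)
    (hK _ _ _ (by positivity) hL0).le hE hEσ
  refine hD.trans_lt ?_
  rw [ENNReal.ofReal_lt_ofReal_iff (by positivity)]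
  have hcL : (L : ℝ) ^ (n - 1) / Real.exp 1 ≤ c :=
    (pow_div_exp_one_le_pow hL0.le hn1).trans hcβ
  have hLn : (L : ℝ) ^ n = L ^ (n - 1) * L := by rw [← pow_succ, Nat.sub_add_cancel hn1]
  have hrn : r * (1 - η / 2) - 1 ≤ n := by
    have h1 : r * k < (n + 1) * (k * (1 + η / 2)) := by
      rw [← hmr]
      refine hnm'.trans_le ?_
      gcongr
      linarith
    have h2 : r < (n + 1) * (1 + η / 2) := by
      apply lt_of_mul_lt_mul_right _ hk'.le
      linarith
    have h3 : r * (1 - η / 2) ≤ (n + 1) * (1 + η / 2) * (1 - η / 2) := by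
      gcongr
      linarith
    nlinarith [sq_nonneg η]
  have hm32 : (m : ℝ) ^ (3 / 2 : ℝ) = m * √m := by
    rw [Real.sqrt_eq_rpow, ← Real.rpow_one_add' hm'.le (by norm_num)]
    norm_num
  -- By `hrn`, `s - n ≤ -(1 - η) r - η r / 4 + 1`, and `η r ≥ 16` leaves a spare factor `L ^ (-3) ≤
  -- 1 / 8`.
  have hexp : (L : ℝ) ^ s / (L : ℝ) ^ n ≤ (L : ℝ) ^ (-((1 - η) * r)) * (1 / 8) := by
    have h1 : (L : ℝ) ^ s / (L : ℝ) ^ n = (L : ℝ) ^ (s - n) := by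
      rw [Real.rpow_sub hL0, Real.rpow_natCast]
    have h2 : (L : ℝ) ^ (-(3 : ℝ)) ≤ 1 / 8 := by
      rw [Real.rpow_neg hL0.le, one_div]
      apply inv_anti₀ (by norm_num)
      calc (8 : ℝ) = 2 ^ (3 : ℝ) := by norm_num
        _ ≤ _ := by gcongr
    rw [h1]
    calc (L : ℝ) ^ (s - n) ≤ (L : ℝ) ^ (-((1 - η) * r) + -3) := by
          apply Real.rpow_le_rpow_of_exponent_le (by linarith)
          rw [hs]
          linarith
      _ = (L : ℝ) ^ (-((1 - η) * r)) * (L : ℝ) ^ (-(3 : ℝ)) := Real.rpow_add hL0 _ _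
      _ ≤ _ := by gcongr
  calc √p * (20 * √m * (n + 1) / L) / ((L : ℝ) ^ (-s) * √p * c)
      = 20 * √m * (n + 1) / L * (L : ℝ) ^ s / c := by
        rw [Real.rpow_neg hL0.le]
        have : 0 < √(p : ℝ) := Real.sqrt_pos.2 hp'
        field_simp
    _ ≤ 20 * √m * (n + 1) / L * (L : ℝ) ^ s / ((L : ℝ) ^ (n - 1) / Real.exp 1) := by
        gcongr
    _ = 20 * Real.exp 1 * √m * (n + 1) * ((L : ℝ) ^ s / L ^ n) := by
        rw [hLn]
        field_simp
    _ ≤ 20 * Real.exp 1 * √m * (2 * r) * ((L : ℝ) ^ (-((1 - η) * r)) * (1 / 8)) := by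
        gcongr
        linarith
    _ = 5 * (Real.exp 1 * (m * √m) * (k : ℝ)⁻¹ * (L : ℝ) ^ (-((1 - η) * r))) := by
        rw [hrdef]
        ring
    _ < 16 * (Real.exp 1 * (m * √m) * (k : ℝ)⁻¹ * (L : ℝ) ^ (-((1 - η) * r))) := by
        gcongr
        norm_num
    _ = _ := by
        rw [hm32]
        ring

theorem mainTheorem2 :
    ∃ c₁ : ℝ, 0 < c₁ ∧
      ∀ (η : ℝ), 0 < η → η < 1 / 2 →
      ∀ (m k : ℕ), 4 / η ≤ (k : ℝ) → 2 * k ≤ m →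
        c₁ / η ^ 2 * Real.log ((m : ℝ) / k) ≤ (m : ℝ) / k →
      ∀ {Ω : Type*} [MeasurableSpace Ω] (P : Measure Ω) [IsProbabilityMeasure P]
        (E : Ω → Matrix (Fin m) (Fin k) ℝ), IsStandardGaussianMatrix E P →
        ∃ G : Set Ω, MeasurableSet G ∧
          1 - 3 * (2 : ℝ) ^ (-(η ^ 2 * m / 40)) - Real.exp (-(2 * m)) ≤ P.real G ∧
          ∀ ω ∈ G, ∀ L : ℕ, 2 ≤ L →
            analysisDistortionLevels (E ω) L <
              ENNReal.ofReal (16 * Real.exp 1 * (m : ℝ) ^ (3 / 2 : ℝ) * (k : ℝ)⁻¹ *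
                (L : ℝ) ^ (-((1 - η) * ((m : ℝ) / k)))) := by
  refine ⟨1000, by norm_num, ?_⟩
  intro η hη hη1 m k hkη hm hr Ω _ P _ E hE
  have hηk : 4 ≤ η * k := by rwa [div_le_iff₀ hη, mul_comm] at hkη
  have hk' : (0 : ℝ) < k := (by positivity : (0 : ℝ) < 4 / η).trans_le hkη
  have hk : 0 < k := by exact_mod_cast hk'
  have hm' : (0 : ℝ) < m := by
    have : 0 < m := by omega
    exact_mod_cast this
  have hr' : 1000 * Real.log ((m : ℝ) / k) ≤ η ^ 2 * (m / k) := by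
    have := mul_le_mul_of_nonneg_left hr (sq_nonneg η)
    refine le_trans (le_of_eq ?_) this
    field_simp
  have hr2 : (2 : ℝ) ≤ m / k := by
    rw [le_div_iff₀ hk']
    exact_mod_cast hm
  have hlog : (0.69 : ℝ) ≤ Real.log ((m : ℝ) / k) := by
    have h1 := Real.log_two_gt_d9
    have h2 := Real.log_le_log two_pos hr2
    linarith
  have hη2 : 690 ≤ η ^ 2 * ((m : ℝ) / k) := by linarith
  have hηr : 16 ≤ η * ((m : ℝ) / k) := by nlinarith
  -- This makes the failure probabilities summable over `L`.
  have ha : 2 ≤ η ^ 2 * m / 40 := by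
    have h1 : η ^ 2 * m = η ^ 2 * ((m : ℝ) / k) * k := by field_simp
    have h2 : (1 : ℝ) ≤ k := by exact_mod_cast hk
    rw [h1]
    nlinarith
  -- Because `η k ≥ 4`, rounding down still leaves an excess of at least `η k / 4`.
  obtain ⟨p, hpdef⟩ : ∃ p, p = k + ⌊η * k / 2⌋₊ := ⟨_, rfl⟩
  have hp_le : (p : ℝ) ≤ k + η * k / 2 := by
    rw [hpdef]
    push_cast
    gcongr
    exact Nat.floor_le (by positivity)
  have hp_ge : (k : ℝ) + η * k / 4 ≤ p := by
    rw [hpdef]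
    push_cast
    have := Nat.lt_floor_add_one (η * k / 2)
    linarith
  have hkp : k ≤ p := by omega
  have hp0 : 0 < p := by omega
  have hp2 : p ≤ 2 * k := by
    have : (p : ℝ) ≤ 2 * k := by nlinarith
    exact_mod_cast this
  have hpm : p ≤ m := hp2.trans hm
  obtain ⟨n, hndef⟩ : ∃ n, n = m / p := ⟨_, rfl⟩
  have hn1 : 1 ≤ n := by rw [hndef, Nat.one_le_div_iff hp0]; exact hpm
  have hpn : p * n ≤ m := by rw [hndef]; exact Nat.mul_div_le m p
  have hnm : m < (n + 1) * p := by
    rw [hndef, mul_comm]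
    exact Nat.lt_mul_div_succ m hp0
  set e : Fin p × Fin n → Fin m := fun s => Fin.castLE hpn (finProdFinEquiv s) with hedef
  have he : Function.Injective e :=
    (Fin.castLE_injective hpn).comp finProdFinEquiv.injective
  set w : ℕ → Fin n → ℝ := fun L i => (L * n / (n + 1) : ℝ) ^ (n - 1 - (i : ℕ)) with hw
  set t : ℕ → ℝ := fun L => (L : ℝ) ^ (-(η * (m / k) / 4)) with ht
  set B₀ : Set (EuclideanSpace ℝ (Fin m × Fin k)) := {g | ∃ x : EuclideanSpace ℝ (Fin k),
    20 * √m * ‖x‖ < ‖WithLp.toLp 2 (matrixOfVec g *ᵥ x.ofLp)‖} with hB₀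
  -- The norm bound is built into each `B L`, so its failure is paid for only once, in `B₀`.
  set B : ℕ → Set (EuclideanSpace ℝ (Fin m × Fin k)) := fun L =>
    {g | (∀ x : EuclideanSpace ℝ (Fin k),
        ‖WithLp.toLp 2 (matrixOfVec g *ᵥ x.ofLp)‖ ≤ 20 * √m * ‖x‖) ∧
      ∃ x : EuclideanSpace ℝ (Fin k),
        ‖WithLp.toLp 2 (blockMatrix e (w L) *ᵥ (matrixOfVec g *ᵥ x.ofLp))‖
          < t L * √p * √(∑ i, w L i ^ 2) * ‖x‖} with hB
  have hBL : ∀ L : ℕ, 2 ≤ L → stdGaussian (EuclideanSpace ℝ (Fin m × Fin k)) (B L)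
      ≤ ENNReal.ofReal ((L : ℝ) ^ (-(η ^ 2 * m / 40))) := by
    intro L hL
    have hL1 : (1 : ℝ) ≤ L := by exact_mod_cast (by omega : 1 ≤ L)
    have hL0 : (0 : ℝ) < L := by linarith
    have hn0 : (0 : ℝ) < n := by exact_mod_cast hn1
    have hc : 0 < √(∑ i, w L i ^ 2) := by
      apply Real.sqrt_pos.2
      have : Nonempty (Fin n) := ⟨⟨0, hn1⟩⟩
      exact Finset.sum_pos (fun i _ => by simp only [hw]; positivity) Finset.univ_nonempty
    refine (stdGaussian_exists_norm_mulVec_lt_le hp0 hpm hc (blockMatrix_mul_transpose he (w L))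
      (t := t L) (by positivity) ?_).trans
      (ENNReal.ofReal_le_ofReal (small_ball_bound_le_rpow hη hk hp_ge hp2 hm hr' hL))
    apply Real.rpow_le_one_of_one_le_of_nonpos hL1
    have : 0 ≤ η * ((m : ℝ) / k) / 4 := by positivity
    linarith
  obtain ⟨hX, hmap⟩ := map_toLp_eq_stdGaussian_of_isStandardGaussianMatrix hE
  obtain ⟨G, hG, hGP, hGB⟩ := exists_measurableSet_compl_of_map hX
    (B := B₀ ∪ ⋃ i : ℕ, B (i + 2))
    (b := Real.exp (-(2 * m)) + 3 * (2 : ℝ) ^ (-(η ^ 2 * m / 40))) (by positivity) (by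
      rw [hmap, ENNReal.ofReal_add (by positivity) (by positivity)]
      refine (measure_union_le _ _).trans (add_le_add
        (stdGaussian_exists_lt_norm_mulVec_le hm (by omega)) ?_)
      refine (measure_iUnion_le _).trans (le_trans ?_ (tsum_ofReal_rpow_neg_le ha))
      exact ENNReal.tsum_le_tsum fun i => hBL (i + 2) (by omega))
  refine ⟨G, hG, by linarith, fun ω hω L hL => ?_⟩
  have h1 := hGB ω hω
  rw [Set.mem_union, not_or, Set.mem_iUnion, not_exists] at h1
  obtain ⟨h2, h3⟩ := h1
  have h4 := h3 (L - 2)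
  rw [Nat.sub_add_cancel hL] at h4
  have h5 : ∀ x : EuclideanSpace ℝ (Fin k),
      ‖WithLp.toLp 2 (E ω *ᵥ x.ofLp)‖ ≤ 20 * √m * ‖x‖ := by
    intro x
    by_contra hx
    exact h2 ⟨x, not_le.1 hx⟩
  refine analysisDistortionLevels_lt hη hη1 hk hkp hp_le hn1 hpn hnm hηr he hL h5 fun x => ?_
  by_contra hx
  exact h4 ⟨h5, x, not_le.1 hx⟩
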